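/- Let $X,Y$ be (real or complex) Hilbert spaces. For a linear operator $A$ with domain $D(A)\subseteq X$ and values in $Y$, let $N(A)$ and $R(A)$ be its null space and range. Write $C(X,Y)$ for the closed linear operators with dense domain in $X$, and $B(X,Y)$ for the bounded everywhere defined ones. The operator $A$ has the *Hyers–Ulam stability* if there is $K>0$ (a *Hyers–Ulam stability constant* for $A$) such that for all $y\in R(A)$, $\varepsilon>0$ and $x\in D(A)$ with $\|Ax-y\|\le\varepsilon$ there is $x_0\in D(A)$ with $Ax_0=y$ and $\|x-x_0\|\le K\varepsilon$; $K_A$ denotes the infimum of all such $K$. A *bounded generalized inverse* of $A\in C(X,Y)$ is an $S\in B(Y,X)$ with $R(S)\subseteq D(A)$, $ASAx=Ax$ for $x\in D(A)$, $SASy=Sy$ for $y\in Y$, and $SA$ continuous on $D(A)$. The *Moore–Penrose inverse* $A^\dagger$ of $A\in C(X,Y)$ is the unique operator $S\in C(Y,X)$ with $D(S)=R(A)+R(A)^\perp$, $ASA=A$ on $D(A)$, $SAS=S$ on $D(S)$, $SA=I-P$ on $D(A)$ and $AS=Q$ on $D(S)$, where $P$ and $Q$ are the orthogonal projectors onto $N(A)$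 and $\overline{R(A)}$. **Corollary 2.2.** Let $T\in C(X,Y)$ have the Hyers–Ulam stability, let $T^+\in B(Y,X)$ be a bounded generalized inverse of $T$, and let $\delta T$ be a linear operator from $D(\delta T)\subseteq X$ to $Y$ that is $T$-bounded with constants $a,b\ge 0$, i.e. $D(T)\subseteq D(\delta T)$ and $\|\delta T x\|\le a\|x\|+b\|Tx\|$ for all $x\in D(T)$. If $$a\|T^+\|+b\|TT^+\|<1\qquad\text{and}\qquad N(T)\subseteq N(\delta T),$$ then $\overline T:=T+\delta T$ (with domain $D(T)$) belongs to $C(X,Y)$ and has the Hyers–Ulam stability, its Moore–Penrose inverse $\overline T^\dagger$ is everywhere defined and bounded, and $$K_{\overline T}=\|\overline T^\dagger\|,$$ where, with $G:=\overline T\,T^+(I+\delta T\,T^+)^{-1}\in B(Y,Y)$, $$\overline T^\dagger=\{I-[(T^+T)^{**}-(T^+T)^*]^2\}^{-1}(T^+T)^*\,T^+(I+\delta T\,T^+)^{-1}\,G^*\,\{I-[G-G^*]^2\}^{-1},$$ all the displayed inverses existing as bounded everywhere defined operators. Here $T^+T$ is the operator with domain $D(T)$, and $(T^+T)^*$, $(T^+T)^{**}$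 are its adjoint and second adjoint, which belong to $B(X,X)$. -/

import Mathlib

namespace HyersUlam

section Operators

variable {𝕜 X Y : Type*} [RCLike 𝕜]
  [NormedAddCommGroup X] [InnerProductSpace 𝕜 X]
  [NormedAddCommGroup Y] [InnerProductSpace 𝕜 Y]

/-- The null space `N(T)`, as a subspace of `X`. -/
def nullSpace (T : X →ₗ.[𝕜] Y) : Submodule 𝕜 X :=
  (LinearMap.ker T.toFun).map T.domain.subtype

/-- The range `R(T)`, as a subspace of `Y`. -/
def rangeSpace (T : X →ₗ.[𝕜] Y) : Submodule 𝕜 Y :=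
  LinearMap.range T.toFun

/-- `T ∈ C(X, Y)`: a closed linear operator with dense domain. -/
structure IsClosedDense (T : X →ₗ.[𝕜] Y) : Prop where
  dense : Dense (T.domain : Set X)
  closed : T.IsClosed

/-- `K` is a Hyers--Ulam stability constant for `T`. -/
def IsHUSConstant (T : X →ₗ.[𝕜] Y) (K : ℝ) : Prop :=
  0 < K ∧ ∀ y ∈ rangeSpace T, ∀ ε : ℝ, 0 < ε → ∀ x : T.domain, ‖T x - y‖ ≤ ε →
    ∃ x₀ : T.domain, T x₀ = y ∧ ‖(x : X) - x₀‖ ≤ K * ε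

/-- `T` has the Hyers--Ulam stability. -/
def HasHUS (T : X →ₗ.[𝕜] Y) : Prop := ∃ K : ℝ, IsHUSConstant T K

/-- `K_T`, the infimum of all Hyers--Ulam stability constants for `T`
(a set of positive reals, which is nonempty exactly when `HasHUS T`). -/
noncomputable def husInf (T : X →ₗ.[𝕜] Y) : ℝ := sInf {K : ℝ | IsHUSConstant T K}

/-- The bounded operator `S : Y → X` is a bounded generalized inverse of `T`. -/
structure IsBoundedGeneralizedInverse (T : X →ₗ.[𝕜] Y) (S : Y →L[𝕜] X) : Prop where
  mem_domain : ∀ y, S y ∈ T.domain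
  TST : ∀ x : T.domain, T ⟨S (T x), mem_domain (T x)⟩ = T x
  STS : ∀ y, S (T ⟨S y, mem_domain y⟩) = S y
  continuous_ST : Continuous fun x : T.domain => S (T x)

/-- `P` is `T`-bounded with (nonnegative) constants `a`, `b`. -/
structure IsRelativelyBounded (T P : X →ₗ.[𝕜] Y) (a b : ℝ) : Prop where
  nonneg_left : 0 ≤ a
  nonneg_right : 0 ≤ b
  domain_le : T.domain ≤ P.domain
  bound : ∀ x : T.domain, ‖P ⟨x, domain_le x.2⟩‖ ≤ a * ‖(x : X)‖ + b * ‖T x‖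

/-- The everywhere defined composition `A S`, for `R(S) ⊆ D(A)`. -/
def compRight (A : X →ₗ.[𝕜] Y) (S : Y →L[𝕜] X) (h : ∀ y, S y ∈ A.domain) : Y →ₗ[𝕜] Y :=
  A.toFun.comp ((S : Y →ₗ[𝕜] X).codRestrict A.domain h)

theorem compRight_apply (A : X →ₗ.[𝕜] Y) (S : Y →L[𝕜] X) (h : ∀ y, S y ∈ A.domain) (y : Y) :
    compRight A S h y = A ⟨S y, h y⟩ := rfl

/-- By the closed graph theorem `T S` is bounded when `T` is closed. -/
theorem compRight_continuous [CompleteSpace Y] {T : X →ₗ.[𝕜] Y} (hT : T.IsClosed)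
    (S : Y →L[𝕜] X) (h : ∀ y, S y ∈ T.domain) : Continuous (compRight T S h) := by
  apply LinearMap.continuous_of_isClosed_graph
  have h2 : ((compRight T S h).graph : Set (Y × Y)) =
      (fun p : Y × Y => (S p.1, p.2)) ⁻¹' (T.graph : Set (X × Y)) := by
    ext ⟨y, z⟩
    simp only [SetLike.mem_coe, LinearMap.mem_graph_iff, Set.mem_preimage,
      LinearPMap.mem_graph_iff, compRight_apply]
    constructor
    · intro hz
      exact ⟨⟨S y, h y⟩, rfl, hz.symm⟩
    · rintro ⟨x, hx, hz⟩
      have : x = ⟨S y, h y⟩ := Subtype.ext hx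
      rw [← hz, this]
  rw [h2]
  exact IsClosed.preimage (by fun_prop) hT

/-- If `P` is `T`-bounded and `T` is closed, then `P S` is bounded. -/
theorem compRight_continuous_of_relBounded [CompleteSpace Y] {T P : X →ₗ.[𝕜] Y}
    (hT : T.IsClosed) {a b : ℝ} (hP : IsRelativelyBounded T P a b)
    (S : Y →L[𝕜] X) (h : ∀ y, S y ∈ T.domain) :
    Continuous (compRight P S fun y => hP.domain_le (h y)) := by
  let C : Y →L[𝕜] Y := ⟨compRight T S h, compRight_continuous hT S h⟩
  refine AddMonoidHomClass.continuous_of_bound _ (a * ‖S‖ + b * ‖C‖) fun y => ?_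
  have h1 : ‖compRight P S (fun y => hP.domain_le (h y)) y‖ ≤ a * ‖S y‖ + b * ‖C y‖ :=
    hP.bound ⟨S y, h y⟩
  have h2 := mul_le_mul_of_nonneg_left (S.le_opNorm y) hP.nonneg_left
  have h3 := mul_le_mul_of_nonneg_left (C.le_opNorm y) hP.nonneg_right
  linarith

/-- `D(T + δT) = D(T)` when `δT` is `T`-bounded. -/
theorem mem_add_domain {T P : X →ₗ.[𝕜] Y} {a b : ℝ} (hP : IsRelativelyBounded T P a b)
    {x : X} (hx : x ∈ T.domain) : x ∈ (T + P).domain :=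
  ⟨hx, hP.domain_le hx⟩

theorem compRight_add_continuous [CompleteSpace Y] {T P : X →ₗ.[𝕜] Y}
    (hT : T.IsClosed) {a b : ℝ} (hP : IsRelativelyBounded T P a b)
    (S : Y →L[𝕜] X) (h : ∀ y, S y ∈ T.domain) :
    Continuous (compRight (T + P) S fun y => mem_add_domain hP (h y)) :=
  (compRight_continuous hT S h).add (compRight_continuous_of_relBounded hT hP S h)

section Bounded

variable [CompleteSpace Y] {T δT : X →ₗ.[𝕜] Y} {S : Y →L[𝕜] X} {a b : ℝ}

/-- `T T⁺ ∈ B(Y)`, where `S = T⁺`. -/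
def opTS (hT : IsClosedDense T) (hS : IsBoundedGeneralizedInverse T S) : Y →L[𝕜] Y :=
  ⟨compRight T S hS.mem_domain, compRight_continuous hT.closed S hS.mem_domain⟩

/-- `δT T⁺ ∈ B(Y)`, where `S = T⁺`. -/
def opPerturbS (hT : IsClosedDense T) (hS : IsBoundedGeneralizedInverse T S)
    (hδ : IsRelativelyBounded T δT a b) : Y →L[𝕜] Y :=
  ⟨compRight δT S fun y => hδ.domain_le (hS.mem_domain y),
    compRight_continuous_of_relBounded hT.closed hδ S hS.mem_domain⟩

/-- `B = T⁺ (I + δT T⁺)⁻¹ ∈ B(Y, X)`. -/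
noncomputable def opB (hT : IsClosedDense T) (hS : IsBoundedGeneralizedInverse T S)
    (hδ : IsRelativelyBounded T δT a b) : Y →L[𝕜] X :=
  S ∘L Ring.inverse (1 + opPerturbS hT hS hδ)

/-- `(T + δT) T⁺ (I + δT T⁺)⁻¹ ∈ B(Y)`. -/
noncomputable def opQ (hT : IsClosedDense T) (hS : IsBoundedGeneralizedInverse T S)
    (hδ : IsRelativelyBounded T δT a b) : Y →L[𝕜] Y :=
  ⟨compRight (T + δT) (opB hT hS hδ) fun _ => mem_add_domain hδ (hS.mem_domain _),
    compRight_add_continuous hT.closed hδ (opB hT hS hδ) fun _ => hS.mem_domain _⟩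

end Bounded

section Adjoint

variable [CompleteSpace X]

theorem adjoint_domain_eq_top {A : X →ₗ.[𝕜] X} (hc : Continuous fun x : A.domain => A x) (y : X) :
    y ∈ A.adjoint.domain := by
  rw [LinearPMap.mem_adjoint_domain_iff]
  exact (innerSL 𝕜 y).continuous.comp hc

/-- The adjoint `A* ∈ B(X)` of a densely defined continuous operator `A : D(A) → X`:
the usual adjoint of an unbounded operator, which here is everywhere defined and bounded. -/
noncomputable def boundedAdjoint (A : X →ₗ.[𝕜] X) (hd : Dense (A.domain : Set X))
    (hc : Continuous fun x : A.domain => A x) : X →L[𝕜] X :=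
  ⟨A.adjoint.toFun.comp (LinearMap.id.codRestrict A.adjoint.domain (adjoint_domain_eq_top hc)), by
    apply LinearMap.continuous_of_isClosed_graph
    convert LinearPMap.adjoint_isClosed hd using 1
    unfold LinearPMap.IsClosed
    congr!
    ext ⟨y, z⟩
    simp only [LinearMap.mem_graph_iff, LinearPMap.mem_graph_iff]
    constructor
    · intro hz
      exact ⟨⟨y, adjoint_domain_eq_top hc y⟩, rfl, hz.symm⟩
    · rintro ⟨x, hx, hz⟩
      obtain rfl : x = ⟨y, adjoint_domain_eq_top hc y⟩ := Subtype.ext hx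
      exact hz.symm⟩

/-- `boundedAdjoint A` is `A*` as an unbounded operator. -/
theorem boundedAdjoint_toPMap (A : X →ₗ.[𝕜] X) (hd : Dense (A.domain : Set X))
    (hc : Continuous fun x : A.domain => A x) :
    (boundedAdjoint A hd hc : X →ₗ[𝕜] X).toPMap ⊤ = A.adjoint := by
  refine LinearPMap.ext (Submodule.ext fun y => ?_) fun y h1 h2 => rfl
  simpa using adjoint_domain_eq_top hc y

/-- `A**` as an unbounded operator is the everywhere defined bounded operator `(A*)*`. -/
theorem adjoint_boundedAdjoint_toPMap (A : X →ₗ.[𝕜] X) (hd : Dense (A.domain : Set X))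
    (hc : Continuous fun x : A.domain => A x) :
    ((boundedAdjoint A hd hc).adjoint : X →ₗ[𝕜] X).toPMap ⊤ = A.adjoint.adjoint := by
  rw [← boundedAdjoint_toPMap A hd hc,
    ContinuousLinearMap.toPMap_adjoint_eq_adjoint_toPMap_of_dense]
  simp

/-- `(T⁺ T)* ∈ B(X)`, where `S = T⁺` and `T⁺ T` has domain `D(T)`. -/
noncomputable def adjST {T : X →ₗ.[𝕜] Y} {S : Y →L[𝕜] X} (hT : IsClosedDense T)
    (hS : IsBoundedGeneralizedInverse T S) : X →L[𝕜] X :=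
  boundedAdjoint ((S : Y →ₗ[𝕜] X).compPMap T) hT.dense hS.continuous_ST

/-- `(T⁺ T)** ∈ B(X)`. -/
noncomputable def biadjST {T : X →ₗ.[𝕜] Y} {S : Y →L[𝕜] X} (hT : IsClosedDense T)
    (hS : IsBoundedGeneralizedInverse T S) : X →L[𝕜] X :=
  (adjST hT hS).adjoint

end Adjoint

section MoorePenrose

variable [CompleteSpace X] [CompleteSpace Y]

/-- `S` is the Moore--Penrose inverse of `T ∈ C(X, Y)`: the operator `S ∈ C(Y, X)` with domain
`R(T) + R(T)ᗮ` such that `T S T = T`, `S T S = S`, `S T = I - P` on `D(T)` and `T S = Q` on `D(S)`,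
where `P` and `Q` are the orthogonal projectors onto `N(T)` (closed, since `T` is) and onto the
closure of `R(T)`. -/
structure IsMoorePenroseInverse (T : X →ₗ.[𝕜] Y) (S : Y →ₗ.[𝕜] X) : Prop where
  closedDense : IsClosedDense S
  domain_eq : S.domain = rangeSpace T ⊔ (rangeSpace T)ᗮ
  mem_domain : ∀ y : S.domain, S y ∈ T.domain
  mem_domain' : ∀ x : T.domain, T x ∈ S.domain
  TST : ∀ x : T.domain, T ⟨S ⟨T x, mem_domain' x⟩, mem_domain _⟩ = T x
  STS : ∀ y : S.domain, S ⟨T ⟨S y, mem_domain y⟩, mem_domain' _⟩ = S y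
  ST : ∀ x : T.domain,
    S ⟨T x, mem_domain' x⟩ = (x : X) - (nullSpace T).topologicalClosure.starProjection (x : X)
  TS : ∀ y : S.domain,
    T ⟨S y, mem_domain y⟩ = (rangeSpace T).topologicalClosure.starProjection (y : Y)

/-- There is at most one Moore--Penrose inverse. -/
theorem IsMoorePenroseInverse.unique {T : X →ₗ.[𝕜] Y} {S₁ S₂ : Y →ₗ.[𝕜] X}
    (h₁ : IsMoorePenroseInverse T S₁) (h₂ : IsMoorePenroseInverse T S₂) : S₁ = S₂ := by
  refine LinearPMap.ext (h₁.domain_eq.trans h₂.domain_eq.symm) fun y hy₁ hy₂ => ?_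
  have e : T ⟨S₁ ⟨y, hy₁⟩, h₁.mem_domain _⟩ = T ⟨S₂ ⟨y, hy₂⟩, h₂.mem_domain _⟩ :=
    (h₁.TS ⟨y, hy₁⟩).trans (h₂.TS ⟨y, hy₂⟩).symm
  have e1 := h₁.STS ⟨y, hy₁⟩
  have e2 := h₂.STS ⟨y, hy₂⟩
  rw [h₂.ST] at e2
  simp only [e] at e1
  rw [h₁.ST] at e1
  exact e1.symm.trans e2

end MoorePenrose

end Operators

end HyersUlam

/-!
Write `R = δT T⁺` and `W = I + R`. Relative boundedness gives `‖R‖ ≤ a ‖T⁺‖ + b ‖T T⁺‖ < 1`, so `W`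
is invertible. Since `x - T⁺ T x ∈ N(T) ⊆ N(δT)` for `x ∈ D(T)`, one has `δT x = δT T⁺ T x`, that is,
`T + δT = W T` (`add_apply_eq`). Hence `T + δT` is closed, and `B = T⁺ W⁻¹` is a bounded generalized
inverse of it with `B (T + δT) = T⁺ T` (`isClosedDense_add`, `isBoundedGeneralizedInverse_opB`). What
remains is a fact about a single closed operator `A` with a bounded generalized inverse `B`.

The operators `E = (B A)**` and `G = A B` are bounded idempotents, with `N(E) = N(A)` and
`R(G) = R(A)`; in particular `R(A)` is closed. For a bounded idempotent `F` on a Hilbert space,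
`(F - F*)² = -(F - F*)* (F - F*)`, so `1 - (F - F*)²` is invertible, and it commutes with `F` and `F*`.
This gives the orthogonal projectors onto `R(F)` and `N(F)ᗮ` as `F F* {1 - (F - F*)²}⁻¹` and
`{1 - (F - F*)²}⁻¹ F* F` (`starProjection_range_of_idempotent`, `starProjection_ker_of_idempotent`).
Compressing `B` by the projectors onto `N(A)ᗮ` and `R(A)` produces the Moore--Penrose inverse
(`isMoorePenroseInverse_moorePenroseOfInverse`), and `E B = B = B G` reduces the product of projector
formulas to the displayed one.

Finally, `‖A† A w‖ ≤ ‖w‖` for `w ∈ D(A)`, so `A† z` is the least-norm solution of `A w = z` and the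
Hyers--Ulam stability constants of `A` are exactly the positive `K ≥ ‖A†‖` (`isHUSConstant_iff`).
-/

namespace HyersUlam

/-! ### Orthogonal projectors from bounded idempotents -/

section Idempotents

/-- If `f` and `g` are idempotent, then `g` commutes with `1 - (f - g) ^ 2`. -/
theorem idempotent_mul_one_sub_sq {R : Type*} [Ring R] {f g : R} (hf : f * f = f)
    (hg : g * g = g) : g * (1 - (f - g) ^ 2) = g * f * g := by
  have h : g * (1 - (f - g) ^ 2) = g - g * (f * f) + g * f * g + g * g * f - g * g * g := by
    noncomm_ring
  rw [h, hf, hg, hg]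
  noncomm_ring

theorem one_sub_sq_mul_idempotent {R : Type*} [Ring R] {f g : R} (hf : f * f = f)
    (hg : g * g = g) : (1 - (f - g) ^ 2) * g = g * f * g := by
  have h : (1 - (f - g) ^ 2) * g = g - f * f * g + f * (g * g) + g * f * g - g * (g * g) := by
    noncomm_ring
  rw [h, hf, hg, hg]
  noncomm_ring

variable {𝕜 H : Type*} [RCLike 𝕜] [NormedAddCommGroup H] [InnerProductSpace 𝕜 H] [CompleteSpace H]

open ContinuousLinearMap

/-- Since `F - F*` is skew-adjoint, `1 - (F - F*)²` is bounded below by the identity. -/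
theorem isUnit_one_sub_sub_adjoint_sq (F : H →L[𝕜] H) : IsUnit (1 - (F - F.adjoint) ^ 2) := by
  refine isUnit_of_forall_le_norm_inner_map _ (c := 1) one_pos fun x => ?_
  have h : inner 𝕜 ((1 - (F - F.adjoint) ^ 2 : H →L[𝕜] H) x) x
      = inner 𝕜 x x + inner 𝕜 ((F - F.adjoint) x) ((F - F.adjoint) x) := by
    simp only [pow_two, sub_apply, one_apply_eq_self, mul_apply_eq_comp, inner_sub_left, inner_sub_right,
      map_sub, adjoint_inner_left, adjoint_inner_right]
    ring
  rw [h, inner_self_eq_norm_sq_to_K, inner_self_eq_norm_sq_to_K]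
  norm_cast
  rw [abs_of_nonneg (by positivity), mul_one]
  exact le_add_of_nonneg_right (sq_nonneg _)

theorem adjoint_mul_self_of_idempotent {F : H →L[𝕜] H} (hF : F * F = F) :
    F.adjoint * F.adjoint = F.adjoint := by
  rw [← star_eq_adjoint, ← star_mul, hF]

/-- The orthogonal projector onto the range of a bounded idempotent `F` is
`F F* {1 - (F - F*)²}⁻¹`. -/
theorem starProjection_range_of_idempotent {F : H →L[𝕜] H} (hF : F * F = F)
    (K : Submodule 𝕜 H) [K.HasOrthogonalProjection] (hK : ∀ y, y ∈ K ↔ F y = y) (y : H) :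
    K.starProjection y = F (F.adjoint (Ring.inverse (1 - (F - F.adjoint) ^ 2 : H →L[𝕜] H) y)) := by
  set V := Ring.inverse (1 - (F - F.adjoint) ^ 2) with hV
  have hF' := adjoint_mul_self_of_idempotent hF
  have key : F.adjoint * F * F.adjoint * V = F.adjoint := by
    rw [← idempotent_mul_one_sub_sq hF hF', mul_assoc,
      Ring.mul_inverse_cancel _ (isUnit_one_sub_sub_adjoint_sq F), mul_one]
  refine Submodule.eq_starProjection_of_mem_of_inner_eq_zero ?_ fun w hw => ?_
  · rw [hK]
    exact congr($hF _)
  · rw [← (hK w).1 hw, ← adjoint_inner_left, map_sub]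
    have : F.adjoint (F (F.adjoint (V y))) = F.adjoint y := congr($key y)
    rw [this, sub_self, inner_zero_left]

/-- The orthogonal projector onto the orthogonal complement of the null space of a bounded
idempotent `F` is `{1 - (F - F*)²}⁻¹ F* F`. -/
theorem starProjection_ker_of_idempotent {F : H →L[𝕜] H} (hF : F * F = F)
    (K : Submodule 𝕜 H) [K.HasOrthogonalProjection] (hK : ∀ y, y ∈ K ↔ F y = 0) (y : H) :
    K.starProjection y = y - Ring.inverse (1 - (F - F.adjoint) ^ 2 : H →L[𝕜] H) (F.adjoint (F y)) := by
  have hU := isUnit_one_sub_sub_adjoint_sq F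
  have hF' := adjoint_mul_self_of_idempotent hF
  have sq_comm : (F - F.adjoint) ^ 2 = (F.adjoint - F) ^ 2 := by noncomm_ring
  set U := 1 - (F - F.adjoint) ^ 2 with hUdef
  have cF : U * F = F * F.adjoint * F := by
    rw [hUdef, sq_comm]; exact one_sub_sq_mul_idempotent hF' hF
  have cF' : F * U = F * F.adjoint * F := by
    rw [hUdef, sq_comm]; exact idempotent_mul_one_sub_sq hF' hF
  have dF : U * F.adjoint = F.adjoint * U :=
    (one_sub_sq_mul_idempotent hF hF').trans (idempotent_mul_one_sub_sq hF hF').symm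
  set V := Ring.inverse U with hV
  have UV : U * V = 1 := Ring.mul_inverse_cancel _ hU
  have VU : V * U = 1 := Ring.inverse_mul_cancel _ hU
  have eF : F * V = V * F := by
    calc F * V = V * (U * F) * V := by rw [← mul_assoc, VU, one_mul]
      _ = V * F * (U * V) := by rw [cF, ← cF']; noncomm_ring
      _ = V * F := by rw [UV, mul_one]
  have eF' : V * F.adjoint = F.adjoint * V := by
    calc V * F.adjoint = V * (F.adjoint * U) * V := by rw [mul_assoc, mul_assoc, UV, mul_one]
      _ = V * U * F.adjoint * V := by rw [← dF]; noncomm_ring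
      _ = F.adjoint * V := by rw [VU, one_mul]
  have key : F * V * F.adjoint * F = F := by
    rw [eF, mul_assoc V, mul_assoc V, ← cF, ← mul_assoc, VU, one_mul]
  refine Submodule.eq_starProjection_of_mem_of_inner_eq_zero ?_ fun w hw => ?_
  · rw [hK, map_sub, sub_eq_zero]
    exact congr($key y).symm
  · have h : V (F.adjoint (F y)) = F.adjoint (V (F y)) := congr($eF' (F y))
    rw [sub_sub_cancel, h, adjoint_inner_left, (hK w).1 hw, inner_zero_right]

end Idempotents

section Operators

variable {𝕜 X Y : Type*} [RCLike 𝕜]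
  [NormedAddCommGroup X] [InnerProductSpace 𝕜 X]
  [NormedAddCommGroup Y] [InnerProductSpace 𝕜 Y]

/-! ### Null spaces -/

theorem mem_nullSpace_iff {T : X →ₗ.[𝕜] Y} (x : T.domain) : (x : X) ∈ nullSpace T ↔ T x = 0 := by
  constructor
  · rintro ⟨z, hz, hzx⟩
    obtain rfl : z = x := Subtype.ext hzx
    exact hz
  · exact fun h => ⟨x, h, rfl⟩

theorem nullSpace_le_domain (T : X →ₗ.[𝕜] Y) : nullSpace T ≤ T.domain := by
  rintro _ ⟨z, -, rfl⟩
  exact z.2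

theorem isClosed_nullSpace {T : X →ₗ.[𝕜] Y} (hT : T.IsClosed) :
    IsClosed (nullSpace T : Set X) := by
  have h : (nullSpace T : Set X) = (fun x => (x, (0 : Y))) ⁻¹' (T.graph : Set (X × Y)) := by
    ext x
    simp only [SetLike.mem_coe, Set.mem_preimage, LinearPMap.mem_graph_iff]
    constructor
    · rintro ⟨z, hz, rfl⟩
      exact ⟨z, rfl, hz⟩
    · rintro ⟨z, rfl, hz⟩
      exact ⟨z, hz, rfl⟩
  rw [h]
  exact IsClosed.preimage (by fun_prop) hT

/-! ### From a bounded generalized inverse to the Moore--Penrose inverse -/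

section GeneralizedInverse

variable {T : X →ₗ.[𝕜] Y} {S : Y →L[𝕜] X}

theorem sub_apply_mem_nullSpace (hS : IsBoundedGeneralizedInverse T S) (x : T.domain) :
    (x : X) - S (T x) ∈ nullSpace T := by
  refine (mem_nullSpace_iff (x - ⟨_, hS.mem_domain _⟩ : T.domain)).2 ?_
  rw [LinearPMap.map_sub, hS.TST, sub_self]

section Biadjoint

variable [CompleteSpace X]

/-- `(T⁺ T)**` is the continuous extension of `T⁺ T`. -/
theorem biadjST_apply (hT : IsClosedDense T) (hS : IsBoundedGeneralizedInverse T S)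
    (x : T.domain) : biadjST hT hS x = S (T x) := by
  refine ext_inner_left 𝕜 fun y => ?_
  rw [biadjST, ContinuousLinearMap.adjoint_inner_right]
  exact LinearPMap.adjoint_isFormalAdjoint (T := (S : Y →ₗ[𝕜] X).compPMap T) hT.dense
    ⟨y, adjoint_domain_eq_top hS.continuous_ST y⟩ x

theorem adjoint_biadjST (hT : IsClosedDense T) (hS : IsBoundedGeneralizedInverse T S) :
    (biadjST hT hS).adjoint = adjST hT hS :=
  ContinuousLinearMap.adjoint_adjoint _

theorem biadjST_apply_inv (hT : IsClosedDense T) (hS : IsBoundedGeneralizedInverse T S) (y : Y) :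
    biadjST hT hS (S y) = S y :=
  (biadjST_apply hT hS ⟨S y, hS.mem_domain y⟩).trans (hS.STS y)

theorem biadjST_mul_self (hT : IsClosedDense T) (hS : IsBoundedGeneralizedInverse T S) :
    biadjST hT hS * biadjST hT hS = biadjST hT hS := by
  refine ContinuousLinearMap.ext fun x => congrFun (Continuous.ext_on hT.dense
    (ContinuousLinearMap.continuous _) (ContinuousLinearMap.continuous _) fun x hx => ?_) x
  change biadjST hT hS (biadjST hT hS x) = biadjST hT hS x
  rw [biadjST_apply hT hS ⟨x, hx⟩, biadjST_apply_inv]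

/-- `(T⁺ T)**` has the same null space as `T`. -/
theorem mem_nullSpace_iff_biadjST (hT : IsClosedDense T) (hS : IsBoundedGeneralizedInverse T S)
    (x : X) : x ∈ nullSpace T ↔ biadjST hT hS x = 0 := by
  constructor
  · intro hx
    have h0 := (mem_nullSpace_iff ⟨x, nullSpace_le_domain T hx⟩).1 hx
    rw [biadjST_apply hT hS ⟨x, nullSpace_le_domain T hx⟩, h0, map_zero]
  · intro hx
    -- `1 - T⁺ T` maps `D(T)` into the closed space `N(T)`, so `1 - (T⁺ T)**` maps `X` into it
    have hmem : ∀ z, z - biadjST hT hS z ∈ nullSpace T := by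
      have hc : IsClosed {z | z - biadjST hT hS z ∈ nullSpace T} :=
        (isClosed_nullSpace hT.closed).preimage (by fun_prop)
      refine fun z => hc.closure_subset_iff.2 (fun z hz => ?_) (hT.dense z)
      rw [Set.mem_ofPred_eq, biadjST_apply hT hS ⟨z, hz⟩]
      exact sub_apply_mem_nullSpace hS ⟨z, hz⟩
    simpa [hx] using hmem x

end Biadjoint

variable [CompleteSpace Y]

theorem opTS_mul_self (hT : IsClosedDense T) (hS : IsBoundedGeneralizedInverse T S) :
    opTS hT hS * opTS hT hS = opTS hT hS :=
  ContinuousLinearMap.ext fun y => hS.TST ⟨S y, hS.mem_domain y⟩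

theorem mem_rangeSpace_iff_opTS (hT : IsClosedDense T) (hS : IsBoundedGeneralizedInverse T S)
    (y : Y) : y ∈ rangeSpace T ↔ opTS hT hS y = y := by
  constructor
  · rintro ⟨x, rfl⟩
    exact hS.TST x
  · exact fun h => ⟨_, h⟩

/-- The range of `T` is closed, being the set of fixed points of the bounded operator `T T⁺`. -/
theorem isClosed_rangeSpace (hT : IsClosedDense T) (hS : IsBoundedGeneralizedInverse T S) :
    IsClosed (rangeSpace T : Set Y) := by
  have h : (rangeSpace T : Set Y) = {y | opTS hT hS y = y} :=
    Set.ext fun y => mem_rangeSpace_iff_opTS hT hS y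
  rw [h]
  exact isClosed_eq (opTS hT hS).continuous continuous_id

variable [CompleteSpace X]

/-- The Moore--Penrose inverse obtained from a bounded generalized inverse `T⁺`: compress `T⁺` by
the orthogonal projectors onto `N(T)ᗮ` and `R(T)`, written in terms of the idempotents `(T⁺ T)**`
and `T T⁺`. The factors `(T⁺ T)**` and `T T⁺` adjacent to `T⁺` are absorbed by it. -/
noncomputable def moorePenroseOfInverse (hT : IsClosedDense T)
    (hS : IsBoundedGeneralizedInverse T S) : Y →L[𝕜] X :=
  Ring.inverse (1 - (biadjST hT hS - adjST hT hS) ^ 2) ∘L adjST hT hS ∘L S ∘L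
    (opTS hT hS).adjoint ∘L Ring.inverse (1 - (opTS hT hS - (opTS hT hS).adjoint) ^ 2)

theorem moorePenroseOfInverse_apply (hT : IsClosedDense T)
    (hS : IsBoundedGeneralizedInverse T S) (y : Y) :
    moorePenroseOfInverse hT hS y = S ((rangeSpace T).topologicalClosure.starProjection y) -
      (nullSpace T).topologicalClosure.starProjection
        (S ((rangeSpace T).topologicalClosure.starProjection y)) := by
  have hN : ∀ x, x ∈ (nullSpace T).topologicalClosure ↔ biadjST hT hS x = 0 := by
    rw [(isClosed_nullSpace hT.closed).submodule_topologicalClosure_eq]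
    exact mem_nullSpace_iff_biadjST hT hS
  have hR : ∀ y, y ∈ (rangeSpace T).topologicalClosure ↔ opTS hT hS y = y := by
    rw [(isClosed_rangeSpace hT hS).submodule_topologicalClosure_eq]
    exact mem_rangeSpace_iff_opTS hT hS
  have hSTS : ∀ z, S (opTS hT hS z) = S z := hS.STS
  rw [starProjection_ker_of_idempotent (biadjST_mul_self hT hS) _ hN, sub_sub_cancel,
    starProjection_range_of_idempotent (opTS_mul_self hT hS) _ hR, hSTS, biadjST_apply_inv,
    adjoint_biadjST]
  rfl

/-- A closed densely defined operator with a bounded generalized inverse has an everywhere defined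
bounded Moore--Penrose inverse. -/
theorem isMoorePenroseInverse_moorePenroseOfInverse (hT : IsClosedDense T)
    (hS : IsBoundedGeneralizedInverse T S) :
    IsMoorePenroseInverse T ((moorePenroseOfInverse hT hS : Y →ₗ[𝕜] X).toPMap ⊤) := by
  set M := moorePenroseOfInverse hT hS
  set P := (nullSpace T).topologicalClosure.starProjection
  set Q := (rangeSpace T).topologicalClosure.starProjection
  have hMapply : ∀ y, M y = S (Q y) - P (S (Q y)) := moorePenroseOfInverse_apply hT hS
  have hPmem : ∀ x, P x ∈ nullSpace T := fun x => by
    have h := Submodule.starProjection_apply_mem (nullSpace T).topologicalClosure x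
    exact (isClosed_nullSpace hT.closed).submodule_topologicalClosure_eq.le h
  have hPself : ∀ x ∈ nullSpace T, P x = x := fun x hx =>
    Submodule.starProjection_eq_self_iff.2 (Submodule.le_topologicalClosure _ hx)
  have hQmem : ∀ y, Q y ∈ rangeSpace T := fun y => by
    have h := Submodule.starProjection_apply_mem (rangeSpace T).topologicalClosure y
    exact (isClosed_rangeSpace hT hS).submodule_topologicalClosure_eq.le h
  have hQself : ∀ y ∈ rangeSpace T, Q y = y := fun y hy =>
    Submodule.starProjection_eq_self_iff.2 (Submodule.le_topologicalClosure _ hy)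
  have hPdom : ∀ x, P x ∈ T.domain := fun x => nullSpace_le_domain T (hPmem x)
  have hdom : ∀ y, M y ∈ T.domain := fun y => by
    rw [hMapply]
    exact T.domain.sub_mem (hS.mem_domain _) (hPdom _)
  have hTM : ∀ y, T ⟨M y, hdom y⟩ = Q y := fun y => by
    have h : (⟨M y, hdom y⟩ : T.domain) = ⟨S (Q y), hS.mem_domain _⟩ - ⟨P (S (Q y)), hPdom _⟩ :=
      Subtype.ext (hMapply y)
    rw [h, LinearPMap.map_sub, (mem_nullSpace_iff ⟨P (S (Q y)), hPdom _⟩).1 (hPmem _), sub_zero]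
    exact (mem_rangeSpace_iff_opTS hT hS _).1 (hQmem y)
  have hMT : ∀ x : T.domain, M (T x) = (x : X) - P x := fun x => by
    have h := hPself _ (sub_apply_mem_nullSpace hS x)
    rw [map_sub, sub_eq_sub_iff_sub_eq_sub] at h
    rw [hMapply, hQself (T x) ⟨x, rfl⟩, ← neg_sub (P _), ← h, neg_sub]
  have hMQ : ∀ y, M (Q y) = M y := fun y => by rw [hMapply, hQself _ (hQmem y), ← hMapply]
  refine
    { closedDense := ⟨by simp, ?_⟩
      domain_eq := ?_
      mem_domain := fun y => hdom y
      mem_domain' := fun _ => Submodule.mem_top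
      TST := fun x => (hTM (T x)).trans (hQself _ ⟨x, rfl⟩)
      STS := fun y => (congrArg M (hTM y)).trans (hMQ y)
      ST := hMT
      TS := fun y => hTM y }
  · have h : (((M : Y →ₗ[𝕜] X).toPMap ⊤).graph : Set (Y × X)) = {p | M p.1 = p.2} := by
      ext ⟨y, x⟩
      simp
    rw [LinearPMap.IsClosed, h]
    exact isClosed_eq (by fun_prop) (by fun_prop)
  · have : CompleteSpace (rangeSpace T) := (isClosed_rangeSpace hT hS).completeSpace_coe
    exact Submodule.sup_orthogonal_of_hasOrthogonalProjection.symm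

end GeneralizedInverse

/-! ### Stability constants and the norm of the Moore--Penrose inverse -/

section StabilityConstants

variable [CompleteSpace X] [CompleteSpace Y] {T : X →ₗ.[𝕜] Y} {M : Y →L[𝕜] X}

/-- If `T†` is bounded and everywhere defined, then `T† z` is the solution of `T w = z` of least
norm for each `z` in the range, so the Hyers--Ulam stability constants are the positive upper
bounds of the norm of `T†`. -/
theorem isHUSConstant_iff (hM : IsMoorePenroseInverse T ((M : Y →ₗ[𝕜] X).toPMap ⊤)) (K : ℝ) :
    IsHUSConstant T K ↔ 0 < K ∧ ‖M‖ ≤ K := by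
  have hdom : ∀ y, M y ∈ T.domain := fun y => hM.mem_domain ⟨y, Submodule.mem_top⟩
  have hTM : ∀ y, T ⟨M y, hdom y⟩ = (rangeSpace T).topologicalClosure.starProjection y :=
    fun y => hM.TS ⟨y, Submodule.mem_top⟩
  have hTMT : ∀ x : T.domain, T ⟨M (T x), hdom _⟩ = T x := hM.TST
  have hMTM : ∀ y, M (T ⟨M y, hdom y⟩) = M y := fun y => hM.STS ⟨y, Submodule.mem_top⟩
  have hle : ∀ x : T.domain, ‖M (T x)‖ ≤ ‖(x : X)‖ := fun x => by
    have h : M (T x) = (x : X) - (nullSpace T).topologicalClosure.starProjection (x : X) := hM.ST x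
    rw [h, ← Submodule.starProjection_orthogonal_val]
    exact Submodule.norm_starProjection_apply_le _ _
  constructor
  · rintro ⟨hK, h⟩
    refine ⟨hK, M.opNorm_le_bound hK.le fun y => ?_⟩
    rcases eq_or_ne y 0 with rfl | hy
    · simp
    -- stability at the range element `0` yields `x₀ ∈ N(T)` with `‖M y - x₀‖ ≤ K ‖y‖`, and removing
    -- `x₀` does not change the image under `M T`
    obtain ⟨x₀, hx₀, hx₀'⟩ := h 0 (Submodule.zero_mem _) ‖y‖ (norm_pos_iff.2 hy) ⟨M y, hdom y⟩ (by
      rw [sub_zero, hTM]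
      exact Submodule.norm_starProjection_apply_le _ _)
    have h1 := hle (⟨M y, hdom y⟩ - x₀)
    rw [LinearPMap.map_sub, hx₀, sub_zero, hMTM] at h1
    exact h1.trans hx₀'
  · rintro ⟨hK, h⟩
    refine ⟨hK, ?_⟩
    rintro _ ⟨u, rfl⟩ ε hε x hx
    refine ⟨x - ⟨M (T (x - u)), hdom _⟩, ?_, ?_⟩
    · rw [LinearPMap.map_sub, hTMT, LinearPMap.map_sub, sub_sub_cancel]
      rfl
    · change ‖(x : X) - ((x : X) - M (T (x - u)))‖ ≤ K * ε
      rw [sub_sub_cancel, LinearPMap.map_sub]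
      exact (M.le_opNorm _).trans (mul_le_mul h hx (norm_nonneg _) hK.le)

theorem hasHUS_of_isMoorePenroseInverse
    (hM : IsMoorePenroseInverse T ((M : Y →ₗ[𝕜] X).toPMap ⊤)) : HasHUS T :=
  ⟨‖M‖ + 1, (isHUSConstant_iff hM _).2 ⟨by positivity, by linarith⟩⟩

theorem husInf_eq_norm (hM : IsMoorePenroseInverse T ((M : Y →ₗ[𝕜] X).toPMap ⊤)) :
    husInf T = ‖M‖ := by
  have h : {K : ℝ | IsHUSConstant T K} = {K | 0 < K ∧ ‖M‖ ≤ K} :=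
    Set.ext fun K => isHUSConstant_iff hM K
  rw [husInf, h]
  refine le_antisymm (le_of_forall_pos_le_add fun ε hε => ?_) (le_csInf ?_ fun K hK => hK.2)
  · exact csInf_le ⟨0, fun K hK => hK.1.le⟩ ⟨by positivity, by linarith⟩
  · exact ⟨‖M‖ + 1, by positivity, by linarith⟩

end StabilityConstants

/-! ### Perturbation of a generalized inverse -/

section Perturbation

variable [CompleteSpace Y] {T δT : X →ₗ.[𝕜] Y} {S : Y →L[𝕜] X} {a b : ℝ}

theorem norm_opPerturbS_le (hT : IsClosedDense T) (hS : IsBoundedGeneralizedInverse T S)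
    (hδ : IsRelativelyBounded T δT a b) :
    ‖opPerturbS hT hS hδ‖ ≤ a * ‖S‖ + b * ‖opTS hT hS‖ := by
  have ha := hδ.nonneg_left
  have hb := hδ.nonneg_right
  refine ContinuousLinearMap.opNorm_le_bound _ (by positivity) fun y => ?_
  have h1 : ‖opPerturbS hT hS hδ y‖ ≤ a * ‖S y‖ + b * ‖opTS hT hS y‖ :=
    hδ.bound ⟨S y, hS.mem_domain y⟩
  have h2 := mul_le_mul_of_nonneg_left (S.le_opNorm y) ha
  have h3 := mul_le_mul_of_nonneg_left ((opTS hT hS).le_opNorm y) hb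
  linarith

theorem isUnit_one_add_opPerturbS (hT : IsClosedDense T) (hS : IsBoundedGeneralizedInverse T S)
    (hδ : IsRelativelyBounded T δT a b) (hab : a * ‖S‖ + b * ‖opTS hT hS‖ < 1) :
    IsUnit (1 + opPerturbS hT hS hδ) := by
  rw [← sub_neg_eq_add]
  refine isUnit_one_sub_of_norm_lt_one ?_
  rw [norm_neg]
  exact (norm_opPerturbS_le hT hS hδ).trans_lt hab

/-- As `x - T⁺ T x` lies in `N(T) ⊆ N(δT)`, the perturbed operator factors as
`T + δT = (I + δT T⁺) T`. -/
theorem add_apply_eq (hT : IsClosedDense T) (hS : IsBoundedGeneralizedInverse T S)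
    (hδ : IsRelativelyBounded T δT a b) (hN : nullSpace T ≤ nullSpace δT) (x : T.domain) :
    (T + δT) ⟨x, mem_add_domain hδ x.2⟩ = (1 + opPerturbS hT hS hδ) (T x) := by
  have h1 : δT (⟨x, hδ.domain_le x.2⟩ - ⟨S (T x), hδ.domain_le (hS.mem_domain _)⟩) = 0 :=
    (mem_nullSpace_iff _).1 (hN (sub_apply_mem_nullSpace hS x))
  rw [LinearPMap.map_sub, sub_eq_zero] at h1
  change T x + δT ⟨x, _⟩ = T x + δT ⟨S (T x), _⟩
  rw [h1]

theorem isClosedDense_add (hT : IsClosedDense T) (hS : IsBoundedGeneralizedInverse T S)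
    (hδ : IsRelativelyBounded T δT a b) (hN : nullSpace T ≤ nullSpace δT)
    (hU : IsUnit (1 + opPerturbS hT hS hδ)) : IsClosedDense (T + δT) := by
  set W := 1 + opPerturbS hT hS hδ with hW
  have hVW : ∀ y, Ring.inverse W (W y) = y := fun y => congr($(Ring.inverse_mul_cancel W hU) y)
  have hWV : ∀ y, W (Ring.inverse W y) = y := fun y => congr($(Ring.mul_inverse_cancel W hU) y)
  refine ⟨hT.dense.mono fun x hx => mem_add_domain hδ hx, ?_⟩
  have h : ((T + δT).graph : Set (X × Y)) =
      (fun p : X × Y => (p.1, Ring.inverse W p.2)) ⁻¹' (T.graph : Set (X × Y)) := by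
    ext ⟨x, y⟩
    simp only [SetLike.mem_coe, Set.mem_preimage, LinearPMap.mem_graph_iff]
    constructor
    · rintro ⟨z, rfl, rfl⟩
      refine ⟨⟨z, z.2.1⟩, rfl, ?_⟩
      change _ = Ring.inverse W ((T + δT) ⟨z, _⟩)
      rw [add_apply_eq hT hS hδ hN ⟨z, z.2.1⟩, hVW]
    · rintro ⟨z, rfl, hz⟩
      refine ⟨⟨z, mem_add_domain hδ z.2⟩, rfl, ?_⟩
      rw [add_apply_eq hT hS hδ hN, hz, hWV]
  rw [LinearPMap.IsClosed, h]
  exact hT.closed.preimage (by fun_prop)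

/-- `T⁺ (I + δT T⁺)⁻¹ (T + δT) = T⁺ T`. -/
theorem opB_add_apply (hT : IsClosedDense T) (hS : IsBoundedGeneralizedInverse T S)
    (hδ : IsRelativelyBounded T δT a b) (hN : nullSpace T ≤ nullSpace δT)
    (hU : IsUnit (1 + opPerturbS hT hS hδ)) (x : T.domain) :
    opB hT hS hδ ((T + δT) ⟨x, mem_add_domain hδ x.2⟩) = S (T x) := by
  rw [add_apply_eq hT hS hδ hN]
  exact congrArg S congr($(Ring.inverse_mul_cancel _ hU) (T x))

theorem isBoundedGeneralizedInverse_opB (hT : IsClosedDense T)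
    (hS : IsBoundedGeneralizedInverse T S) (hδ : IsRelativelyBounded T δT a b)
    (hN : nullSpace T ≤ nullSpace δT) (hU : IsUnit (1 + opPerturbS hT hS hδ)) :
    IsBoundedGeneralizedInverse (T + δT) (opB hT hS hδ) where
  mem_domain y := mem_add_domain hδ (hS.mem_domain _)
  TST x := by
    have h := opB_add_apply hT hS hδ hN hU ⟨x, x.2.1⟩
    have h' : (⟨opB hT hS hδ ((T + δT) x), mem_add_domain hδ (hS.mem_domain _)⟩ :
        (T + δT).domain) = ⟨S (T ⟨x, x.2.1⟩), mem_add_domain hδ (hS.mem_domain _)⟩ :=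
      Subtype.ext h
    rw [h', add_apply_eq hT hS hδ hN ⟨S (T ⟨x, x.2.1⟩), hS.mem_domain _⟩, hS.TST]
    exact (add_apply_eq hT hS hδ hN ⟨x, x.2.1⟩).symm
  STS y := (opB_add_apply hT hS hδ hN hU ⟨opB hT hS hδ y, hS.mem_domain _⟩).trans (hS.STS _)
  continuous_ST := by
    have h : (fun x : (T + δT).domain => opB hT hS hδ ((T + δT) x)) =
        (fun x : T.domain => S (T x)) ∘ fun x : (T + δT).domain => ⟨x, x.2.1⟩ :=
      funext fun x => opB_add_apply hT hS hδ hN hU ⟨x, x.2.1⟩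
    rw [h]
    exact hS.continuous_ST.comp (by fun_prop)

variable [CompleteSpace X]

theorem boundedAdjoint_congr {A B : X →ₗ.[𝕜] X} (h : A = B) (hA : Dense (A.domain : Set X))
    (hA' : Continuous fun x : A.domain => A x) (hB : Dense (B.domain : Set X))
    (hB' : Continuous fun x : B.domain => B x) :
    boundedAdjoint A hA hA' = boundedAdjoint B hB hB' := by
  subst h
  rfl

theorem adjST_opB (hT : IsClosedDense T) (hS : IsBoundedGeneralizedInverse T S)
    (hδ : IsRelativelyBounded T δT a b) (hN : nullSpace T ≤ nullSpace δT)
    (hU : IsUnit (1 + opPerturbS hT hS hδ)) :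
    adjST (isClosedDense_add hT hS hδ hN hU) (isBoundedGeneralizedInverse_opB hT hS hδ hN hU) =
      adjST hT hS := by
  refine boundedAdjoint_congr ?_ _ _ _ _
  refine LinearPMap.ext (inf_eq_left.2 hδ.domain_le) fun x hx hx' => ?_
  exact opB_add_apply hT hS hδ hN hU ⟨x, hx'⟩

end Perturbation

end Operators

end HyersUlam

open HyersUlam in
theorem corollary2p2 {𝕜 X Y : Type*} [RCLike 𝕜]
    [NormedAddCommGroup X] [InnerProductSpace 𝕜 X] [CompleteSpace X]
    [NormedAddCommGroup Y] [InnerProductSpace 𝕜 Y] [CompleteSpace Y]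
    (T : X →ₗ.[𝕜] Y) (hT : HyersUlam.IsClosedDense T) (hHUS : HyersUlam.HasHUS T)
    (S : Y →L[𝕜] X) (hS : HyersUlam.IsBoundedGeneralizedInverse T S)
    (δT : X →ₗ.[𝕜] Y) (a b : ℝ) (hδ : HyersUlam.IsRelativelyBounded T δT a b)
    (hab : a * ‖S‖ + b * ‖HyersUlam.opTS hT hS‖ < 1)
    (hN : HyersUlam.nullSpace T ≤ HyersUlam.nullSpace δT) :
    HyersUlam.IsClosedDense (T + δT) ∧
    HyersUlam.HasHUS (T + δT) ∧
    IsUnit (1 + HyersUlam.opPerturbS hT hS hδ) ∧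
    IsUnit (1 - (HyersUlam.biadjST hT hS - HyersUlam.adjST hT hS) ^ 2) ∧
    IsUnit (1 - (HyersUlam.opQ hT hS hδ - (HyersUlam.opQ hT hS hδ).adjoint) ^ 2) ∧
    ∃ M : Y →L[𝕜] X,
      HyersUlam.IsMoorePenroseInverse (T + δT) ((M : Y →ₗ[𝕜] X).toPMap ⊤) ∧
      HyersUlam.husInf (T + δT) = ‖M‖ ∧
      M = Ring.inverse (1 - (HyersUlam.biadjST hT hS - HyersUlam.adjST hT hS) ^ 2) ∘L
          HyersUlam.adjST hT hS ∘L
          S ∘L Ring.inverse (1 + HyersUlam.opPerturbS hT hS hδ) ∘L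
          (HyersUlam.opQ hT hS hδ).adjoint ∘L
          Ring.inverse
            (1 - (HyersUlam.opQ hT hS hδ - (HyersUlam.opQ hT hS hδ).adjoint) ^ 2) := by
  have hU := isUnit_one_add_opPerturbS hT hS hδ hab
  have hA := isClosedDense_add hT hS hδ hN hU
  have hB := isBoundedGeneralizedInverse_opB hT hS hδ hN hU
  have hM := isMoorePenroseInverse_moorePenroseOfInverse hA hB
  have hadj : adjST hA hB = adjST hT hS := adjST_opB hT hS hδ hN hU
  have hE := isUnit_one_sub_sub_adjoint_sq (biadjST hT hS)
  rw [adjoint_biadjST] at hE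
  refine ⟨hA, hasHUS_of_isMoorePenroseInverse hM, hU, hE, isUnit_one_sub_sub_adjoint_sq _,
    moorePenroseOfInverse hA hB, hM, husInf_eq_norm hM, ?_⟩
  rw [moorePenroseOfInverse, biadjST, hadj]
  rfl
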